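/- Let $p$ be a prime, $q=p^a$ with $a\ge 1$, $\mathbb{Z}_q=W(\mathbb{F}_q)$, $\mathbb{Q}_q=\mathbb{Z}_q[1/p]$, and let $\sigma$ be the Frobenius automorphism of $\mathbb{Q}_q$ over $\mathbb{Q}_p$. Let $d\ge 1$ and $f(x)=\sum_{i=0}^d a_ix^i\in\mathbb{F}_q[x]$, and let $\hat a_i\in\mathbb{Z}_q$ be the Teichmüller lift of $a_i$. Let $0\le u\le q-2$, write $u=u_0+u_1p+\cdots+u_{a-1}p^{a-1}$ with $0\le u_i\le p-1$, and put $u_{i+a}=u_i$. Let $b$ be the least positive integer with $p^bu\equiv u \pmod{q-1}$, and let $0\le s_i<q-1$ be the residue of $p^iu$ modulo $q-1$. Write $\{x\}'=1+x-\lceil x\rceil$ and $$\varepsilon(u)=\min_{1\le i\le b} d\,\{u_i/d\}'.$$ For $n\ge 0$ put $\delta^{(i)}_{\in}(n)=1$ if $pl+u_{b-i}\equiv n\pmod d$ for some integer $0\le l<d\{n/d\}$, where $\{\cdot\}$ is the fractional part, and $\delta^{(i)}_{\in}(n)=0$ otherwise. For integers $n\ge 0$ put $$P_{[0,d],u}(n)=\sum_{m=0}^{n-1}\frac1b\sum_{i=0}^{b-1}\Big(\Big\lceil\frac{(p-1)m+u_{b-i}}{d}\Big\rceil-\delta^{(i)}_{\in}(m)\Big).$$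 Let $E(x)=\exp\big(\sum_{i\ge 0}x^{p^i}/p^i\big)$ be the Artin-Hasse series, let $\pi^{1/(d(q-1))}$ be a formal variable (so that $\mathbb{Z}_q[[\pi]]=\mathbb{Z}_q[[T]]$ with $E(\pi)=1+T$), and let $\mathrm{ord}_\pi$ be the $\pi$-adic order on power series in $\pi^{1/(d(q-1))}$, normalized by $\mathrm{ord}_\pi(\pi)=1$. Write $$E_f(x)=\prod_{i=0}^dE(\pi\hat a_ix^i)=\sum_{n\ge 0}\gamma_nx^n,\qquad \gamma_n=0\ \text{ for } n<0.$$ On formal series in $x$ with exponents in $\frac1{q-1}\mathbb{Z}_{\ge 0}$ and coefficients in $\mathbb{Q}_q[[\pi^{1/(d(q-1))}]]$ let $\psi_p\big(\sum_v b_vx^v\big)=\sum_v b_{pv}x^v$, let $\sigma^{-1}$ act on the coefficients in $\mathbb{Q}_q$, fixing $x$ and $\pi^{1/(d(q-1))}$, and let $\Psi=\sigma^{-1}\circ\psi_p\circ E_f$ be Dwork's operator, where $E_f$ stands for multiplication by $E_f(x)$. Let $\xi_1,\dots,\xi_a$ be a normal basis of $\mathbb{Q}_q$ over $\mathbb{Q}_p$,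 and let $\Gamma$ be the matrix, with entries in $\mathbb{Q}_p[[\pi^{1/(d(q-1))}]]$, of $\Psi$ with respect to the elements $\xi_vx^{s_i/(q-1)+j}$ for $1\le v\le a$, $0\le i\le b-1$, $j\ge 0$. For $N\ge 0$ let $C_N$ be the sum of all principal $N\times N$ minors of $\Gamma$, so that $\det(1-\Gamma s)=\sum_{N\ge 0}(-1)^NC_Ns^N$ is the Fredholm determinant of $\Psi$. **Theorem.** Suppose $p>4d-\varepsilon(u)$ and let $n\ge 0$ be an integer. Then the $\pi$-adic sum defining $C_{abn}$ converges (every power of $\pi^{1/(d(q-1))}$ occurs in only finitely many of the minors), $$\mathrm{ord}_\pi(C_{abn})\ \ge\ ab\,P_{[0,d],u}(n),$$ and, for some choice of the sign, $$\mathrm{ord}_\pi\Big(C_{abn}\mp\mathrm{Norm}\Big(\prod_{i=1}^b\det\big(\gamma_{pl-j+u_{b-i}}\big)_{0\le l,j\le n-1}\Big)\Big)\ \ge\ ab\,P_{[0,d],u}(n)+\frac1{d(q-1)},$$ where $\mathrm{Norm}$ is the norm map from $\mathbb{Q}_q[[\pi^{1/(d(q-1))}]]$ to $\mathbb{Q}_p[[\pi^{1/(d(q-1))}]]$.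 -/

import Mathlib

open scoped PowerSeries

noncomputable section

/-! ## Combinatorial data attached to `p`, `a`, `d`, `u` (with `q = p ^ a`) -/

/-- The base-`p` digit `u_i` of `0 ≤ u ≤ q - 2`, extended periodically with period `a`, so that
`u / (q - 1) = -(u_0 + u_1 p + u_2 p ^ 2 + ⋯)`. -/
def twistDigit (p a u i : ℕ) : ℕ := u / p ^ (i % a) % p

/-- `b`: the least positive integer with `p ^ b * u ≡ u` modulo `q - 1`. -/
def twistPeriod (p a u : ℕ) : ℕ :=
  sInf {b : ℕ | 0 < b ∧ p ^ b * u ≡ u [MOD p ^ a - 1]}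

/-- `s_i`: the residue of `p ^ i * u` modulo `q - 1`. -/
def twistResidue (p a u i : ℕ) : ℕ := p ^ i * u % (p ^ a - 1)

/-- `{x}' = 1 + x - ⌈x⌉`. -/
def fracPrime (x : ℝ) : ℝ := 1 + x - ⌈x⌉

/-- `ε(u) = min { d {u_i / d}' | 1 ≤ i ≤ b }`, a minimum over a finite non-empty set. -/
def twistEpsilon (p a d u : ℕ) : ℝ :=
  sInf ((fun i : ℕ => (d : ℝ) * fracPrime ((twistDigit p a u i : ℝ) / d)) ''
    Set.Icc 1 (twistPeriod p a u))

open Classical in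
/-- `δ_∈^{(i)}(n)`, which is `1` if `p l + u_{b-i} ≡ n` modulo `d` for some natural number
`l < d {n / d} = n % d`, and `0` otherwise. -/
def deltaIn (p a d u i n : ℕ) : ℤ :=
  if ∃ l < n % d, p * l + twistDigit p a u (twistPeriod p a u - i) ≡ n [MOD d] then 1 else 0

/-- The slope `ω(n)` of the arithmetic polygon on the interval `[n, n + 1]`. -/
def arithmeticSlope (p a d u n : ℕ) : ℚ :=
  (1 / (twistPeriod p a u : ℚ)) * ∑ i ∈ Finset.range (twistPeriod p a u),
    ((⌈(((p : ℚ) - 1) * n + twistDigit p a u (twistPeriod p a u - i)) / d⌉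
      - deltaIn p a d u i n : ℤ) : ℚ)

/-- The value `P_{[0,d],u}(n)` of the arithmetic polygon at the natural number `n`. -/
def arithmeticPolygon (p a d u n : ℕ) : ℚ :=
  ∑ m ∈ Finset.range n, arithmeticSlope p a d u m

/-! ## The unramified field `ℚ_q` -/

section UnramifiedField

variable (p : ℕ) [Fact p.Prime] (k : Type*) [Field k] [CharP k p]

/-- `ℚ_q`, the fraction field of `ℤ_q = W(𝔽_q)`, where `k = 𝔽_q`. -/
def QQ : Type _ := FractionRing (WittVector p k)

instance : Field (QQ p k) := inferInstanceAs (Field (FractionRing (WittVector p k)))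

instance : Algebra (WittVector p k) (QQ p k) :=
  inferInstanceAs (Algebra (WittVector p k) (FractionRing (WittVector p k)))

instance : IsFractionRing (WittVector p k) (QQ p k) :=
  inferInstanceAs (IsFractionRing (WittVector p k) (FractionRing (WittVector p k)))

/-- The natural embedding `ℤ_p = W(𝔽_p) → W(k) → ℚ_q`. -/
def padicIntToQQ [Algebra (ZMod p) k] : ℤ_[p] →+* QQ p k :=
  (algebraMap (WittVector p k) (QQ p k)).comp
    ((WittVector.map (algebraMap (ZMod p) k)).comp
      (WittVector.equiv p).symm.toRingHom)

theorem padicIntToQQ_injective [Algebra (ZMod p) k] :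
    Function.Injective (padicIntToQQ p k) := by
  refine (IsFractionRing.injective (WittVector p k) (QQ p k)).comp ?_
  exact (WittVector.map_injective _ (algebraMap (ZMod p) k).injective).comp
    (WittVector.equiv p).symm.injective

/-- `ℚ_q` as an extension of `ℚ_p`. -/
instance [Algebra (ZMod p) k] : Algebra ℚ_[p] (QQ p k) :=
  (IsFractionRing.lift (padicIntToQQ_injective p k) : ℚ_[p] →+* QQ p k).toAlgebra

/-- The Frobenius automorphism `σ` of `ℚ_q`. -/
def sigmaQQ [PerfectRing k p] : QQ p k ≃+* QQ p k :=
  IsFractionRing.ringEquivOfRingEquiv (WittVector.frobeniusEquiv p k)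

/-- The Teichmüller lift `k → W(k) ⊆ ℚ_q`. -/
def teichQQ (c : k) : QQ p k := algebraMap (WittVector p k) (QQ p k) (WittVector.teichmuller p c)

end UnramifiedField

/-! ## The Artin-Hasse series and the series `E_f` -/

/-- `E(x) = exp (∑ x ^ (p ^ i) / p ^ i)`. -/
def artinHasse (p : ℕ) : ℚ⟦X⟧ :=
  open Classical in
  (PowerSeries.exp ℚ).subst
    (PowerSeries.mk fun n => if ∃ i : ℕ, n = p ^ i then (1 / n : ℚ) else 0 : ℚ⟦X⟧)

section Dwork

variable (p : ℕ) [Fact p.Prime] {k : Type*} [Field k] [CharP k p]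

/-- `ℚ_q[[ϖ]]`, where `ϖ = π ^ (1 / (d (q - 1)))` is the power series variable. (The variable `T`
is recovered as `E(π) - 1`, a uniformizer of `ℚ_p[[π]] = ℚ_p[[T]]`.) -/
abbrev QQPi (k : Type*) [Field k] [CharP k p] : Type _ := (QQ p k)⟦X⟧

/-- The series `E(π c x ^ e) = ∑ λ_r c ^ r π ^ r x ^ (e r)` in the variable `x`, where
`π = ϖ ^ D`. The coefficient of `ϖ ^ m` in that of `x ^ j` collects all `r` with `D r = m` and
`e r = j`; for `D ≥ 1` these satisfy `r ≤ m`. -/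
def artinHasseAt (D : ℕ) (c : QQ p k) (e : ℕ) : (QQPi p k)⟦X⟧ :=
  PowerSeries.mk fun j => PowerSeries.mk fun m =>
    ∑ r ∈ Finset.range (m + 1),
      if D * r = m ∧ e * r = j then
        ((PowerSeries.coeff r (artinHasse p) : ℚ) : QQ p k) * c ^ r else 0

/-- `E_f(x) = ∏_{i = 0}^{d} E(π â_i x ^ i)`, for `f = ∑ a_i x ^ i`. -/
def dworkSeries (a d : ℕ) (f : Polynomial k) : (QQPi p k)⟦X⟧ :=
  ∏ i ∈ Finset.range (d + 1),
    artinHasseAt p (d * (p ^ a - 1)) (teichQQ p k (f.coeff i)) i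

/-- `γ_n`: the coefficient of `x ^ n` in `E_f(x)`; it is zero for `n < 0`. -/
def dworkGamma (a d : ℕ) (f : Polynomial k) (n : ℤ) : QQPi p k :=
  if 0 ≤ n then PowerSeries.coeff n.toNat (dworkSeries p a d f) else 0

/-! ## Dwork's operator

A formal series in `x` with exponents in `(1 / (q - 1)) ℕ` is a power series in
`y = x ^ (1 / (q - 1))`; the monomial `x ^ v` is `y ^ ((q - 1) v)`. Multiplication by `E_f(x)`, the
map `ψ_p` and `σ⁻¹` make sense on all such series. The space `B_{p^i u}` consists of series in
the monomials `x ^ v` with `v ≡ s_i / (q - 1)` modulo `1`, that is, `y ^ (s_i + (q - 1) j)`. -/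

/-- Multiplication by `E_f(x)`, where `x = y ^ (q - 1)`. -/
def mulDworkSeries (a d : ℕ) (f : Polynomial k) (g : (QQPi p k)⟦X⟧) : (QQPi p k)⟦X⟧ :=
  (dworkSeries p a d f).subst ((PowerSeries.X : (QQPi p k)⟦X⟧) ^ (p ^ a - 1)) * g

/-- `ψ_p (∑ b_v x ^ v) = ∑ b_{p v} x ^ v`. -/
def psiP (g : (QQPi p k)⟦X⟧) : (QQPi p k)⟦X⟧ :=
  PowerSeries.mk fun m => PowerSeries.coeff (p * m) g

/-- `σ⁻¹`, acting on the coefficients in `ℚ_q` and fixing `ϖ` and `x`. -/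
def sigmaInv [PerfectRing k p] : (QQPi p k)⟦X⟧ →+* (QQPi p k)⟦X⟧ :=
  PowerSeries.map (PowerSeries.map (sigmaQQ p k).symm.toRingHom)

/-- Dwork's semi-linear operator `Ψ = σ⁻¹ ∘ ψ_p ∘ E_f(x)`. -/
def dworkOperator [PerfectRing k p] (a d : ℕ) (f : Polynomial k) (g : (QQPi p k)⟦X⟧) :
    (QQPi p k)⟦X⟧ :=
  sigmaInv p (psiP p (mulDworkSeries p a d f g))

/-- The indices `(v, i, j)` of the basis `ξ_v x ^ (s_i / (q - 1) + j)` of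
`B = ⨁_{0 ≤ i < b} B_{p^i u}` over `ℚ_p`-coefficients. -/
abbrev DworkIndex (p a u : ℕ) : Type := Fin a × Fin (twistPeriod p a u) × ℕ

/-- The exponent `s_i + (q - 1) j` of `y` in the monomial `x ^ (s_i / (q - 1) + j)`. -/
def dworkExponent {p a u : ℕ} (r : DworkIndex p a u) : ℕ :=
  twistResidue p a u r.2.1 + (p ^ a - 1) * r.2.2

/-- The matrix `Γ` of `Ψ` on `B` in the basis `ξ_v x ^ (s_i / (q - 1) + j)`, with
entries in `ℚ_p[[ϖ]]`: the column of an index is the image of its basis element. (The orthonormal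
basis of `B` is obtained by rescaling `x ^ v` to `π ^ (v / d) x ^ v`; this conjugates `Γ` by a
diagonal matrix and does not change its principal minors.) -/
def dworkMatrix [Algebra (ZMod p) k] [PerfectRing k p] (a d u : ℕ) (f : Polynomial k)
    (ξ : Module.Basis (Fin a) ℚ_[p] (QQ p k)) :
    Matrix (DworkIndex p a u) (DworkIndex p a u) (ℚ_[p])⟦X⟧ :=
  Matrix.of fun r c => PowerSeries.mk fun m =>
    ξ.repr
      (PowerSeries.coeff m (PowerSeries.coeff (dworkExponent r)
        (dworkOperator p a d f
          (PowerSeries.monomial (dworkExponent c) (PowerSeries.C (ξ c.1)))))) r.1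

end Dwork

/-! ## Fredholm determinants, orders and norms -/

section Fredholm

variable {ι K : Type*} [DecidableEq ι] [Field K]

/-- The principal minor of an infinite matrix on a finite set of indices. -/
def principalMinor (M : Matrix ι ι K⟦X⟧) (S : Finset ι) : K⟦X⟧ :=
  (M.submatrix (fun r : S => (r : ι)) (fun r : S => (r : ι))).det

/-- The sum of all principal `N × N` minors of `M` converges for the adic topology of `K[[ϖ]]`:
each power of `ϖ` occurs in only finitely many of them. -/
def MinorsConverge (M : Matrix ι ι K⟦X⟧) (N : ℕ) : Prop :=
  ∀ m : ℕ, {S : Finset ι | S.card = N ∧ PowerSeries.coeff m (principalMinor M S) ≠ 0}.Finite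

/-- `C_N`: the sum of all principal `N × N` minors of `M`, so that
`det (1 - M s) = ∑ (-1) ^ N C_N s ^ N`. The sum is formed coefficient by coefficient. -/
def fredholmCoeff (M : Matrix ι ι K⟦X⟧) (N : ℕ) : K⟦X⟧ :=
  PowerSeries.mk fun m =>
    ∑ᶠ S : {S : Finset ι // S.card = N}, PowerSeries.coeff m (principalMinor M S)

/-- The `π`-adic order on `K[[ϖ]]`, where `π = ϖ ^ D`; it is `⊤` exactly at `0`. -/
def piOrder (D : ℕ) (C : K⟦X⟧) : WithTop ℚ :=
  WithTop.map (fun m : ℕ => (m : ℚ) / D) C.order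

end Fredholm

end

noncomputable section

/-! ## The digits and residues of the twist -/

section Twist

variable {p a u : ℕ}

/-! Call the indices with a given `i` a block. Since `p s_i = s_{i+1} + (q-1) u_{b-i-1}`, Dwork's
operator carries block `i+1` (mod `b`) into block `i`. The entry in row `l`, column `j` is a
coordinate of `σ⁻¹(γ_{pl-j+v} ξ)` with `v = u_{b-i-1}`. Only integral powers of `π` occur in `γ_m`,
all at least `m/d`, so for each `t ≥ 0` the entry has order at least `⌊(pl+v+t)/d⌋ - ⌊(j+t)/d⌋`.
This bound separates rows from columns, so every term of a principal minor on `S` has order at least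
the sum over `S` of the weights `⌊(pl+v+t)/d⌋ - ⌊(l+t)/d⌋`, whatever its permutation.

A nonzero term permutes the blocks cyclically, so `S` meets all blocks equally often. The hypothesis
gives `p > 3d`, because `ε(u) ≤ d`, and then the weight grows by at least 2 with each step in `l`.
Hence among the sets of size `abn` that matter, the one with all exponents below `n` has the least
total weight `W`, and any other has at least `W + 2` (`sum_indexWeight_add_le`). For `t ≡ -n` modulo
`d`, a count of residues gives `W ≥ ab P(n)` (`sum_ceil_sub_delta_le`).

The remaining minor is a norm up to sign (`principalMinor_leadingIndices`): `σ⁻¹` permutes a normal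
basis, so permuting rows and columns turns the matrix into the regular representation of a block
diagonal matrix of `γ`'s. -/

theorem twistResidue_of_le (hp : 1 < p) (hu : u < p ^ a - 1) {i : ℕ} (hi : i ≤ a) :
    twistResidue p a u i = u / p ^ (a - i) + u % p ^ (a - i) * p ^ i := by
  have hpa : p ^ (a - i) * p ^ i = p ^ a := by rw [← pow_add]; congr 1; omega
  have hA : 0 < p ^ (a - i) := by positivity
  have hB : 0 < p ^ i := by positivity
  rw [twistResidue]
  generalize p ^ (a - i) = A at *
  generalize p ^ i = B at *
  have hdm := Nat.div_add_mod u A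
  have hr := Nat.mod_lt u hA
  have hh : u / A < B := by rw [Nat.div_lt_iff_lt_mul hA]; nlinarith [Nat.sub_le (p ^ a) 1]
  generalize u / A = h at *
  generalize u % A = r at *
  obtain ⟨Q, hQ⟩ : ∃ Q, p ^ a = Q + 1 := ⟨p ^ a - 1, by omega⟩
  rw [hQ, Nat.add_sub_cancel] at hu
  rw [hQ] at hpa ⊢
  rw [Nat.add_sub_cancel]
  -- With `u = A h + r` and `A B = Q + 1`, the top digits `h` re-enter at the bottom modulo `Q`.
  have key : B * u = h + r * B + Q * h := by
    have : B * (A * h + r) = (A * B) * h + r * B := by ring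
    rw [← hdm, this, hpa]; ring
  rw [key, Nat.add_mul_mod_self_left]
  apply Nat.mod_eq_of_lt
  -- The rotated number can reach `Q` only if every digit is `p - 1`, that is `u = q - 1`.
  by_contra hcon
  have h1 : (r + 1) * B ≤ A * B := Nat.mul_le_mul_right _ hr
  have h2 : h = B - 1 := by nlinarith [h1]
  have h3 : (r + 1) * B = A * B := by
    have : h + 1 = B := by omega
    nlinarith
  have h4 : r + 1 = A := Nat.eq_of_mul_eq_mul_right hB h3
  have : u + 1 = A * B := by
    have : h + 1 = B := by omega
    rw [← hdm, ← this]; rw [← h4]; ring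
  omega

/-- Multiplication by `p` modulo `q - 1` rotates the base-`p` digits; the quotient is the digit
pushed out at the top. -/
theorem mul_twistResidue_eq (hp : 1 < p) (hu : u < p ^ a - 1) {i : ℕ} (hi : i < a) :
    p * twistResidue p a u i =
      twistResidue p a u (i + 1) + (p ^ a - 1) * twistDigit p a u (a - 1 - i) := by
  rw [twistResidue_of_le hp hu hi.le, twistResidue_of_le hp hu hi, twistDigit,
    Nat.mod_eq_of_lt (by omega : a - 1 - i < a)]
  have e1 : a - i = (a - 1 - i) + 1 := by omega
  have e2 : a - (i + 1) = a - 1 - i := by omega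
  have hpa : p ^ (a - 1 - i) * p ^ (i + 1) = p ^ a := by rw [← pow_add]; congr 1; omega
  rw [e1, e2, pow_succ, pow_succ, Nat.mod_mul, ← Nat.div_div_eq_div_mul]
  rw [pow_succ] at hpa
  have hA : 0 < p ^ (a - 1 - i) := by positivity
  have hB : 0 < p ^ i := by positivity
  generalize p ^ (a - 1 - i) = A at *
  generalize p ^ i = B at *
  have h1 := Nat.div_add_mod (u / A) p
  obtain ⟨Q, hQ⟩ : ∃ Q, p ^ a = Q + 1 := ⟨p ^ a - 1, by omega⟩
  rw [hQ] at hpa ⊢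
  rw [Nat.add_sub_cancel]
  generalize u / A % p = e at *
  generalize u / A / p = h at *
  rw [← h1]
  have : A * (B * p) * e = (Q + 1) * e := by rw [hpa]
  linear_combination this

theorem twistPeriod_spec (ha : 0 < a) (hu : u < p ^ a - 1) :
    0 < twistPeriod p a u ∧ p ^ twistPeriod p a u * u ≡ u [MOD p ^ a - 1] := by
  refine Nat.sInf_mem (s := {b : ℕ | 0 < b ∧ p ^ b * u ≡ u [MOD p ^ a - 1]}) ⟨a, ha, ?_⟩
  have : p ^ a ≡ 1 [MOD p ^ a - 1] := by
    refine ((Nat.modEq_iff_dvd' (by omega)).2 dvd_rfl).symm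
  simpa using this.mul_right u

theorem twistResidue_period (ha : 0 < a) (hu : u < p ^ a - 1) (i : ℕ) :
    twistResidue p a u (i + twistPeriod p a u) = twistResidue p a u i := by
  have := (twistPeriod_spec ha hu).2.mul_left (p ^ i)
  rwa [← mul_assoc, ← pow_add] at this

theorem twistResidue_period_mul (ha : 0 < a) (hu : u < p ^ a - 1) (i c : ℕ) :
    twistResidue p a u (i + twistPeriod p a u * c) = twistResidue p a u i := by
  induction c with
  | zero => simp
  | succ c ih => rw [mul_add, mul_one, ← add_assoc, twistResidue_period ha hu, ih]

/-- As `p` is invertible modulo `q - 1`, a coincidence would yield a period shorter than the minimal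
one. -/
theorem twistResidue_inj (ha : 0 < a) (hu : u < p ^ a - 1) {i j : ℕ} (hij : i ≤ j)
    (h : twistResidue p a u i = twistResidue p a u j) (hlt : j < i + twistPeriod p a u) :
    i = j := by
  by_contra hne
  have hcop : Nat.Coprime (p ^ a - 1) (p ^ i) := by
    apply Nat.Coprime.pow_right
    have h1 : Nat.Coprime (p ^ a - 1) (p ^ a) := by
      obtain ⟨Q, hQ⟩ : ∃ Q, p ^ a = Q + 1 := ⟨p ^ a - 1, by omega⟩
      rw [hQ]; simp
    exact Nat.Coprime.coprime_dvd_right (dvd_pow_self p ha.ne') h1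
  have h' : p ^ i * u ≡ p ^ i * (p ^ (j - i) * u) [MOD p ^ a - 1] := by
    rw [← mul_assoc, ← pow_add, Nat.add_sub_cancel' hij]; exact h
  have h2 := Nat.ModEq.cancel_left_of_coprime hcop h'
  have h3 : twistPeriod p a u ≤ j - i := Nat.sInf_le ⟨by omega, h2.symm⟩
  omega

theorem twistPeriod_dvd (ha : 0 < a) (hu : u < p ^ a - 1) :
    twistPeriod p a u ∣ a := by
  have hb := (twistPeriod_spec ha hu).1
  have h1 : twistResidue p a u a = twistResidue p a u 0 := by
    have : p ^ a ≡ 1 [MOD p ^ a - 1] :=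
      ((Nat.modEq_iff_dvd' (by omega)).2 dvd_rfl).symm
    have h := this.mul_right u
    rw [one_mul] at h
    rw [twistResidue, twistResidue, pow_zero, one_mul]
    exact h
  have h2 := twistResidue_period_mul ha hu (a % twistPeriod p a u) (a / twistPeriod p a u)
  rw [Nat.mod_add_div, h1] at h2
  have := twistResidue_inj ha hu (Nat.zero_le _) h2 (by simpa using Nat.mod_lt _ hb)
  exact Nat.dvd_of_mod_eq_zero this.symm

/-- The residues depend only on `i` modulo `b`, so `i` can be moved to the last of the `a / b`
periods, where the digit index `a - 1 - i` becomes `b - (i + 1)`. -/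
theorem mul_twistResidue (ha : 0 < a) (hp : 1 < p) (hu : u < p ^ a - 1) {i : ℕ}
    (hi : i < twistPeriod p a u) :
    p * twistResidue p a u i = twistResidue p a u (i + 1) +
      (p ^ a - 1) * twistDigit p a u (twistPeriod p a u - (i + 1)) := by
  obtain ⟨c, hc⟩ := twistPeriod_dvd ha hu
  set b := twistPeriod p a u with hb
  have hc0 : 0 < c := Nat.pos_of_ne_zero (by rintro rfl; omega)
  obtain ⟨c, rfl⟩ : ∃ c', c = c' + 1 := ⟨c - 1, by omega⟩
  have h := mul_twistResidue_eq hp hu (i := i + b * c) (by rw [hc, mul_add]; omega)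
  rw [twistResidue_period_mul ha hu, show i + b * c + 1 = i + 1 + b * c by ring,
    twistResidue_period_mul ha hu] at h
  rwa [show a - 1 - (i + b * c) = b - (i + 1) by rw [mul_add] at hc; omega] at h

/-- For `b < a`, evaluating `p s_{b-1}` in the last and in the next-to-last period produces the
digits `u_0` and `u_b`; for `b = a` the indices agree modulo `a`. -/
theorem twistDigit_period (ha : 0 < a) (hp : 1 < p) (hu : u < p ^ a - 1) :
    twistDigit p a u (twistPeriod p a u) = twistDigit p a u 0 := by
  have hb := (twistPeriod_spec ha hu).1
  have h1 := mul_twistResidue ha hp hu (Nat.sub_lt hb one_pos)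
  obtain ⟨c, hc⟩ := twistPeriod_dvd ha hu
  set b := twistPeriod p a u with hb'
  rcases Nat.lt_or_ge c 2 with hc2 | hc2
  · have : c = 1 := by
      have : c ≠ 0 := by rintro rfl; omega
      omega
    rw [this, mul_one] at hc
    simp [twistDigit, ← hc]
  obtain ⟨c, rfl⟩ : ∃ c', c = c' + 2 := ⟨c - 2, by omega⟩
  have h := mul_twistResidue_eq hp hu (i := b - 1 + b * c) (by rw [hc, mul_add]; omega)
  rw [twistResidue_period_mul ha hu, show b - 1 + b * c + 1 = b - 1 + 1 + b * c by ring,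
    twistResidue_period_mul ha hu, h1, show a - 1 - (b - 1 + b * c) = b by
      rw [mul_add] at hc; omega, show b - (b - 1 + 1) = 0 by omega] at h
  exact (Nat.eq_of_mul_eq_mul_left (by omega) (Nat.add_left_cancel h)).symm

theorem twistResidue_eq_succ_iff (ha : 0 < a) (hu : u < p ^ a - 1) {i j : ℕ}
    (hj : j < twistPeriod p a u) :
    twistResidue p a u j = twistResidue p a u (i + 1) ↔ j = (i + 1) % twistPeriod p a u := by
  have hb := (twistPeriod_spec ha hu).1
  have hper : twistResidue p a u ((i + 1) % twistPeriod p a u) = twistResidue p a u (i + 1) := by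
    conv_rhs => rw [← Nat.mod_add_div (i + 1) (twistPeriod p a u)]
    rw [twistResidue_period_mul ha hu]
  rw [← hper]
  have hm := Nat.mod_lt (i + 1) hb
  refine ⟨fun h => ?_, fun h => by rw [h]⟩
  rcases le_total j ((i + 1) % twistPeriod p a u) with hle | hle
  · exact twistResidue_inj ha hu hle h (by omega)
  · exact (twistResidue_inj ha hu hle h.symm (by omega)).symm

theorem twistEpsilon_le (ha : 0 < a) (hu : u < p ^ a - 1) (d : ℕ) :
    twistEpsilon p a d u ≤ d := by
  have hb := (twistPeriod_spec ha hu).1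
  refine (csInf_le (((Set.finite_Icc _ _).image _).bddBelow)
    ⟨1, Set.mem_Icc.2 ⟨le_rfl, hb⟩, rfl⟩).trans ?_
  have : fracPrime ((twistDigit p a u 1 : ℝ) / d) ≤ 1 := by
    rw [fracPrime]; linarith [Int.le_ceil ((twistDigit p a u 1 : ℝ) / d)]
  exact mul_le_of_le_one_right (Nat.cast_nonneg d) this

end Twist

/-! ## The weights -/

/-- The contribution of the exponent `l` to the order of a principal minor. -/
def twistWeight (p d t v l : ℕ) : ℤ := (p * l + v + t : ℕ) / (d : ℤ) - (l + t : ℕ) / (d : ℤ)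

section Weight

variable {p d : ℕ}

/-- Splits the bound on the order of an entry into a row part and a column part. The shift `t` is
free here and is fixed later in terms of `n`. -/
theorem floor_sub_floor_le (hd : 0 < d) {x y t : ℕ} {m : ℤ} (h : (x : ℤ) - y ≤ d * m) :
    ((x + t : ℕ) : ℤ) / d - ((y + t : ℕ) : ℤ) / d ≤ m := by
  have hd' : (0 : ℤ) < d := by exact_mod_cast hd
  rw [sub_le_iff_le_add, ← Int.lt_add_one_iff, Int.ediv_lt_iff_lt_mul hd']
  have := Int.lt_ediv_add_one_mul_self ((y + t : ℕ) : ℤ) hd'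
  push_cast at *
  linarith

/-- Per step in `l`, the first floor gains at least 3 because `p > 3d`, and the second at most 1. -/
theorem twistWeight_add_le (hd : 0 < d) (hpd : 3 * d < p) (t v l h : ℕ) :
    twistWeight p d t v l + 2 * h ≤ twistWeight p d t v (l + h) := by
  have hd' : (0 : ℤ) < d := by exact_mod_cast hd
  have h1 : ((p * l + v + t : ℕ) : ℤ) / d + 3 * h ≤ ((p * (l + h) + v + t : ℕ) : ℤ) / d := by
    rw [Int.le_ediv_iff_mul_le hd']
    have := Int.ediv_mul_le ((p * l + v + t : ℕ) : ℤ) hd'.ne'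
    have h3 : (3 * d : ℤ) * h ≤ p * h :=
      mul_le_mul_of_nonneg_right (by exact_mod_cast hpd.le) (by positivity)
    push_cast at *
    linarith
  have h2 : ((l + h + t : ℕ) : ℤ) / d ≤ ((l + t : ℕ) : ℤ) / d + h := by
    rw [← Int.lt_add_one_iff, Int.ediv_lt_iff_lt_mul hd']
    have := Int.lt_ediv_add_one_mul_self ((l + t : ℕ) : ℤ) hd'
    have h3 : (h : ℤ) ≤ h * d := by exact_mod_cast Nat.le_mul_of_pos_right h hd
    push_cast at *
    linarith
  unfold twistWeight
  linarith

theorem two_mul_le_twistWeight (hd : 0 < d) (hpd : 3 * d < p) (t v l : ℕ) :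
    2 * (l : ℤ) ≤ twistWeight p d t v l := by
  have h := twistWeight_add_le hd hpd t v 0 l
  have h0 : 0 ≤ twistWeight p d t v 0 := by
    unfold twistWeight
    rw [sub_nonneg]
    exact Int.ediv_le_ediv (by exact_mod_cast hd) (by push_cast; linarith)
  rw [zero_add] at h
  linarith

end Weight

/-! ## Comparison with the arithmetic polygon -/

theorem sum_range_mul_add_mod {M : Type*} [AddCommMonoid M] (F : ℕ → M) {d R : ℕ} (hR : R ≤ d)
    (k : ℕ) :
    ∑ m ∈ Finset.range (d * k + R), F (m % d) =
      k • ∑ r ∈ Finset.range d, F r + ∑ r ∈ Finset.range R, F r := by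
  have hmod : ∀ R ≤ d, ∑ r ∈ Finset.range R, F (r % d) = ∑ r ∈ Finset.range R, F r :=
    fun R hR => Finset.sum_congr rfl fun r hr => by
      rw [Nat.mod_eq_of_lt ((Finset.mem_range.1 hr).trans_le hR)]
  induction k with
  | zero => simp [hmod R hR]
  | succ k ih =>
    rw [show d * (k + 1) + R = d + (d * k + R) by ring, Finset.sum_range_add]
    simp only [Nat.add_mod_left]
    rw [ih, hmod d le_rfl, succ_nsmul', add_assoc]

/-- Termwise the difference of the two sides is at most a function `F` of `m` modulo `d`. Its sum is
nonpositive over a full period and over the final `R = d - t` residues, and `n = dk + R`. -/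
theorem sum_ceil_sub_delta_le {p d : ℕ} (hcop : Nat.Coprime p d) (hd : 0 < d) (v n t : ℕ)
    (ht : t < d) (hnt : d ∣ n + t) :
    ∑ m ∈ Finset.range n, (⌈(((p : ℚ) - 1) * m + v) / d⌉ -
      (open Classical in if ∃ l < m % d, p * l + v ≡ m [MOD d] then (1 : ℤ) else 0)) ≤
    ∑ m ∈ Finset.range n, twistWeight p d t v m := by
  classical
  rcases Nat.eq_zero_or_pos n with rfl | hn
  · simp
  obtain ⟨c, hc⟩ := hnt
  have hc0 : 0 < c := Nat.pos_of_ne_zero (by rintro rfl; omega)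
  obtain ⟨k, rfl⟩ : ∃ k, c = k + 1 := ⟨c - 1, by omega⟩
  set R := d - t with hR
  have hnR : n = d * k + R := by rw [mul_add] at hc; omega
  set φ : ℕ → ℕ := fun l => (p * l + v) % d with hφ
  have hφlt : ∀ l, φ l < d := fun l => Nat.mod_lt _ hd
  have hφmod : ∀ m, φ (m % d) = φ m := fun m => by
    simp only [hφ]
    exact ((Nat.mod_modEq m d).mul_left p).add_right v
  have hinj : Set.InjOn φ (Finset.range d : Finset ℕ) := by
    intro x hx y hy hxy
    have h1 : p * x ≡ p * y [MOD d] := Nat.ModEq.add_right_cancel' v hxy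
    have h2 := Nat.ModEq.cancel_left_of_coprime (Nat.coprime_comm.1 hcop) h1
    have hx' := Finset.mem_range.1 (Finset.mem_coe.1 hx)
    have hy' := Finset.mem_range.1 (Finset.mem_coe.1 hy)
    exact Nat.ModEq.eq_of_lt_of_lt h2 hx' hy'
  set δ : ℕ → ℤ := fun r => if ∃ l < r, φ l = r then 1 else 0 with hδ
  set F : ℕ → ℤ := fun r =>
    (if r < φ r then 1 else 0) - δ r - (if R ≤ φ r then 1 else 0) + (if R ≤ r then 1 else 0)
    with hF
  -- If `r < φ r`, then `r` itself witnesses `δ (φ r) = 1`, and `φ` is injective on residues since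
  -- `p` is prime to `d`.
  have hpart : ∀ s ≤ d, ∑ r ∈ Finset.range s, (if r < φ r ∧ φ r < s then (1 : ℤ) else 0) ≤
      ∑ r ∈ Finset.range s, δ r := by
    intro s hs
    simp only [hδ]
    rw [Finset.sum_boole, Finset.sum_boole]
    refine Nat.cast_le.2 (Finset.card_le_card_of_injOn φ ?_ ?_)
    · intro r hr
      simp only [Finset.coe_filter, Finset.mem_range, Set.mem_ofPred_eq] at hr ⊢
      exact ⟨hr.2.2, r, hr.2.1, rfl⟩
    · refine hinj.mono fun r hr => ?_
      simp only [Finset.coe_filter, Finset.mem_range, Set.mem_ofPred_eq] at hr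
      simpa using hr.1.trans_le hs
  have himg : (Finset.range d).image φ = Finset.range d := by
    refine Finset.eq_of_subset_of_card_le (fun x hx => ?_) ?_
    · obtain ⟨l, -, rfl⟩ := Finset.mem_image.1 hx
      exact Finset.mem_range.2 (hφlt l)
    · rw [Finset.card_image_of_injOn hinj]
  have hperm : ∑ r ∈ Finset.range d, (if R ≤ φ r then (1 : ℤ) else 0) =
      ∑ r ∈ Finset.range d, (if R ≤ r then (1 : ℤ) else 0) := by
    conv_rhs => rw [← himg, Finset.sum_image hinj]
  have hfull : ∑ r ∈ Finset.range d, F r ≤ 0 := by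
    have h1 := hpart d le_rfl
    simp only [hφlt, and_true] at h1
    simp only [hF, Finset.sum_add_distrib, Finset.sum_sub_distrib]
    linarith
  -- For `r < R` the last indicator vanishes, and `R ≤ φ r` cancels the cases of `r < φ r` that
  -- leave the range.
  have hRpart : ∑ r ∈ Finset.range R, F r ≤ 0 := by
    have h1 := hpart R (by omega)
    have h2 : ∑ r ∈ Finset.range R, F r ≤ ∑ r ∈ Finset.range R,
        ((if r < φ r ∧ φ r < R then (1 : ℤ) else 0) - δ r) := by
      refine Finset.sum_le_sum fun r hr => ?_
      have hr' := Finset.mem_range.1 hr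
      simp only [hF]
      split_ifs <;> omega
    rw [Finset.sum_sub_distrib] at h2
    linarith
  have hsum : ∑ m ∈ Finset.range n, F (m % d) ≤ 0 := by
    rw [hnR, sum_range_mul_add_mod F (by omega)]
    have := nsmul_nonpos hfull k
    linarith
  rw [← sub_nonpos, ← Finset.sum_sub_distrib]
  refine (Finset.sum_le_sum fun m _ => ?_).trans hsum
  have hdel : (if ∃ l < m % d, p * l + v ≡ m [MOD d] then (1 : ℤ) else 0) = δ (m % d) := rfl
  rw [hdel]
  simp only [hF, hφmod]
  have e1 := Nat.div_add_mod (p * m + v) d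
  have e2 := Nat.div_add_mod m d
  have l1 := hφlt m
  have l2 := Nat.mod_lt m hd
  change d * _ + φ m = _ at e1
  -- Adding `t` carries into the quotient exactly when the remainder is at least `R = d - t`.
  have hw : twistWeight p d t v m = ((p * m + v) / d : ℕ) + (if R ≤ φ m then 1 else 0) -
      ((m / d : ℕ) + (if R ≤ m % d then 1 else 0)) := by
    have aux : ∀ x r : ℕ, d * (x / d) + r = x → r < d →
        ((x + t : ℕ) : ℤ) / d = (x / d : ℕ) + (if R ≤ r then 1 else 0) := by
      intro x r hx hr
      have : (x + t) / d = x / d + (if R ≤ r then 1 else 0) := by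
        rw [Nat.div_eq_iff hd]
        split_ifs with h
        · rw [add_mul, mul_comm (x / d)]; omega
        · rw [add_mul, mul_comm (x / d)]; omega
      rw [← Int.natCast_div, this]
      push_cast
      rfl
    rw [twistWeight, aux _ _ e1 l1, aux _ _ e2 l2]
  have hceil : ⌈(((p : ℚ) - 1) * m + v) / d⌉ ≤
      ((p * m + v) / d : ℕ) - ((m / d : ℕ) : ℤ) + (if m % d < φ m then 1 else 0) := by
    rw [Int.ceil_le, div_le_iff₀ (by exact_mod_cast hd)]
    have e1' : ((d * ((p * m + v) / d) + φ m : ℕ) : ℚ) = (p * m + v : ℕ) := by rw [e1]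
    have e2' : ((d * (m / d) + m % d : ℕ) : ℚ) = (m : ℕ) := by rw [e2]
    have l1' : (φ m : ℚ) ≤ d := by exact_mod_cast l1.le
    have l2' : (0 : ℚ) ≤ (m % d : ℕ) := by positivity
    clear hw
    generalize (p * m + v) / d = x at e1' ⊢
    generalize m / d = y at e2' ⊢
    push_cast at e1' e2' ⊢
    split_ifs with h
    · linarith
    · have h' : (φ m : ℚ) ≤ (m % d : ℕ) := by exact_mod_cast not_lt.1 h
      linarith
  rw [hw]
  linarith

/-! ## Orders of principal minors -/

section Minors

variable {ι K : Type*} [Field K]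

theorem sum_le_of_coeff_prod_ne_zero {κ : Type*} (s : Finset κ) (f : κ → K⟦X⟧) (c : κ → ℤ)
    (hf : ∀ i ∈ s, ∀ m : ℕ, PowerSeries.coeff m (f i) ≠ 0 → c i ≤ m) {m : ℕ}
    (hm : PowerSeries.coeff m (∏ i ∈ s, f i) ≠ 0) : ∑ i ∈ s, c i ≤ m := by
  classical
  induction s using Finset.induction_on generalizing m with
  | empty => simp
  | insert i s his ih =>
    rw [Finset.prod_insert his, PowerSeries.coeff_mul] at hm
    obtain ⟨x, hx, hne⟩ := Finset.exists_ne_zero_of_sum_ne_zero hm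
    have h1 := hf i (Finset.mem_insert_self _ _) _ (left_ne_zero_of_mul hne)
    have h2 := ih (fun j hj => hf j (Finset.mem_insert_of_mem hj)) (right_ne_zero_of_mul hne)
    rw [Finset.sum_insert his, ← Finset.HasAntidiagonal.mem_antidiagonal.1 hx]
    push_cast
    linarith

theorem card_fiber_mul {S : Finset ι} (g : ι → ℕ) {b : ℕ} (hg : ∀ r, g r < b)
    (h : ∀ i < b, (S.filter fun r => g r = i).card = (S.filter fun r => g r = 0).card) :
    b * (S.filter fun r => g r = 0).card = S.card := by
  rw [Finset.card_eq_sum_card_fiberwise (s := S) (f := g) (t := Finset.range b)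
    fun r _ => Finset.mem_coe.2 (Finset.mem_range.2 (hg r)),
    Finset.sum_congr rfl fun i hi => h i (Finset.mem_range.1 hi)]
  simp

theorem le_piOrder {D : ℕ} {C : K⟦X⟧} {c : ℚ}
    (h : ∀ m : ℕ, (m : ℚ) / D < c → PowerSeries.coeff m C = 0) :
    (c : WithTop ℚ) ≤ piOrder D C := by
  rw [piOrder]
  rcases h0 : C.order with _ | m
  · exact le_top
  · have hm : PowerSeries.coeff m C ≠ 0 := by
      have hC : C ≠ 0 := by
        rintro rfl
        rw [PowerSeries.order_zero] at h0
        exact WithTop.top_ne_coe h0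
      have := PowerSeries.coeff_order hC
      simp only [h0] at this
      exact this
    refine WithTop.coe_le_coe.2 ?_
    by_contra hlt
    exact hm (h m (not_le.1 hlt))

variable [DecidableEq ι]

/-- The row parts are merely permuted by `τ`, so the bound on a term of the expansion does not
depend on `τ`. -/
theorem sum_le_of_coeff_principalMinor_ne_zero (M : Matrix ι ι K⟦X⟧) (α β : ι → ℤ)
    (hM : ∀ r c, ∀ m : ℕ, PowerSeries.coeff m (M r c) ≠ 0 → α r - β c ≤ m) {S : Finset ι} {m : ℕ}
    (hm : PowerSeries.coeff m (principalMinor M S) ≠ 0) :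
    ∑ r ∈ S, (α r - β r) ≤ m ∧ ∃ τ : Equiv.Perm S, ∀ r : S, M (τ r) r ≠ 0 := by
  rw [principalMinor, Matrix.det_apply, map_sum] at hm
  obtain ⟨τ, -, hτ⟩ := Finset.exists_ne_zero_of_sum_ne_zero hm
  have hne : PowerSeries.coeff m (∏ r : S, M (τ r) r) ≠ 0 := by
    intro h0
    apply hτ
    rcases Int.units_eq_one_or (Equiv.Perm.sign τ) with h | h <;>
      simpa [h] using h0
  refine ⟨?_, τ, fun r hr => hne ?_⟩
  · have h := sum_le_of_coeff_prod_ne_zero Finset.univ (fun r : S => M (τ r) r)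
      (fun r => α (τ r) - β r) (fun r _ m hm => hM _ _ m hm) hne
    rw [Finset.sum_sub_distrib, Equiv.sum_comp τ (fun r : S => α r)] at h
    rw [← Finset.sum_coe_sort, Finset.sum_sub_distrib]
    exact h
  · rw [Finset.prod_eq_zero (Finset.mem_univ r) hr, map_zero]

/-- The inverse of `τ` injects each fibre into the next one; going once around the cycle forces all
cardinalities to agree. -/
theorem card_fiber_eq_of_perm {R : Type*} [Zero R] (M : Matrix ι ι R) (g : ι → ℕ) {b : ℕ}
    (hb : 0 < b) (hM : ∀ r c, M r c ≠ 0 → g c = (g r + 1) % b) {S : Finset ι}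
    (τ : Equiv.Perm S) (hτ : ∀ r : S, M (τ r) r ≠ 0) {i : ℕ} (hi : i < b) :
    (S.filter fun r => g r = i).card = (S.filter fun r => g r = 0).card := by
  set N : ℕ → ℕ := fun i => (S.filter fun r => g r = i).card with hN
  have hle : ∀ i, N i ≤ N ((i + 1) % b) := by
    intro i
    refine Finset.card_le_card_of_injOn
      (fun r => if h : r ∈ S then (τ.symm ⟨r, h⟩ : ι) else r) (fun r hr => ?_) ?_
    · obtain ⟨hrS, hri⟩ := Finset.mem_filter.1 (Finset.mem_coe.1 hr)
      have h := hM _ _ (hτ (τ.symm ⟨r, hrS⟩))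
      rw [Equiv.apply_symm_apply] at h
      simp only [hrS, dif_pos, Finset.mem_coe, Finset.mem_filter]
      exact ⟨(τ.symm ⟨r, hrS⟩).2, by rw [h, hri]⟩
    · intro r hr s hs hrs
      have hrS := (Finset.mem_filter.1 (Finset.mem_coe.1 hr)).1
      have hsS := (Finset.mem_filter.1 (Finset.mem_coe.1 hs)).1
      simp only [hrS, hsS, dif_pos] at hrs
      simpa using τ.symm.injective (Subtype.ext hrs)
  have hmono : ∀ j, ∀ i, i + j < b → N i ≤ N (i + j) := by
    intro j
    induction j with
    | zero => intro i _; exact le_rfl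
    | succ j ih =>
      intro i hij
      refine (ih i (by omega)).trans ((hle _).trans_eq ?_)
      rw [Nat.mod_eq_of_lt (by omega), add_assoc]
  have h0 := hmono i 0 (by omega)
  have h1 := hmono (b - 1 - i) i (by omega)
  have h2 := hle (b - 1)
  rw [zero_add] at h0
  rw [show i + (b - 1 - i) = b - 1 by omega] at h1
  rw [show b - 1 + 1 = b by omega, Nat.mod_self] at h2
  exact le_antisymm (h1.trans h2) h0

/-- Exchange argument: `A \ B` and `B \ A` have equal size, and both are compared with the maximum
of `w` on `B \ A`. -/
theorem sum_add_le_sum_of_card_eq {A B : Finset ι} (hcard : A.card = B.card) (w : ι → ℤ) {δ : ℤ}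
    (hδ : 0 ≤ δ) (hw : ∀ r ∈ B, ∀ s ∈ A, s ∉ B → w r + δ ≤ w s) :
    ∑ r ∈ B, w r + (if A = B then 0 else δ) ≤ ∑ r ∈ A, w r := by
  split_ifs with hAB
  · simp [hAB]
  have hc : (A \ B).card = (B \ A).card := Finset.card_sdiff_comm hcard
  have hne : (B \ A).Nonempty := by
    rw [Finset.nonempty_iff_ne_empty]
    intro h
    exact hAB (Finset.eq_of_subset_of_card_le (Finset.sdiff_eq_empty_iff_subset.1 h) hcard.le).symm
  obtain ⟨r₀, hr₀, hmax⟩ := Finset.exists_max_image (B \ A) w hne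
  have h1 : ∑ r ∈ B \ A, w r ≤ (B \ A).card • w r₀ := Finset.sum_le_card_nsmul _ _ _ hmax
  have h2 : (A \ B).card • (w r₀ + δ) ≤ ∑ r ∈ A \ B, w r :=
    Finset.card_nsmul_le_sum _ _ _ fun s hs =>
      hw r₀ (Finset.mem_sdiff.1 hr₀).1 s (Finset.mem_sdiff.1 hs).1 (Finset.mem_sdiff.1 hs).2
  have h3 := Finset.sum_sdiff_sub_sum_sdiff (s₁ := B) (s₂ := A) (f := w)
  have h4 : (1 : ℤ) ≤ (B \ A).card := by exact_mod_cast Finset.card_pos.2 hne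
  rw [hc] at h2
  rw [nsmul_eq_mul] at h1 h2
  nlinarith

theorem sum_add_le_sum_of_card_fiber_eq {S T : Finset ι} (g : ι → ℕ) {b : ℕ} (hg : ∀ r, g r < b)
    (hcard : ∀ i < b, (S.filter fun r => g r = i).card = (T.filter fun r => g r = i).card)
    (w : ι → ℤ) {δ : ℤ} (hδ : 0 ≤ δ)
    (hw : ∀ r ∈ T, ∀ s, s ∉ T → g r = g s → w r + δ ≤ w s) (hST : S ≠ T) :
    ∑ r ∈ T, w r + δ ≤ ∑ r ∈ S, w r := by
  have hfib : ∀ U : Finset ι, ∑ r ∈ U, w r =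
      ∑ i ∈ Finset.range b, ∑ r ∈ U.filter (fun r => g r = i), w r := fun U =>
    (Finset.sum_fiberwise_of_maps_to (fun r _ => Finset.mem_range.2 (hg r)) w).symm
  have hle : ∀ i ∈ Finset.range b, ∑ r ∈ T.filter (fun r => g r = i), w r +
      (if S.filter (fun r => g r = i) = T.filter (fun r => g r = i) then 0 else δ) ≤
      ∑ r ∈ S.filter (fun r => g r = i), w r := by
    intro i hi
    refine sum_add_le_sum_of_card_eq (hcard i (Finset.mem_range.1 hi)) w hδ ?_
    intro r hr s hs hsT
    simp only [Finset.mem_filter, not_and] at hr hs hsT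
    exact hw r hr.1 s (fun h => hsT h hs.2) (hr.2.trans hs.2.symm)
  have hex : ∃ i ∈ Finset.range b,
      S.filter (fun r => g r = i) ≠ T.filter (fun r => g r = i) := by
    by_contra! hcon
    apply hST
    ext r
    have := congrArg (r ∈ ·) (hcon (g r) (Finset.mem_range.2 (hg r)))
    simpa using this
  obtain ⟨i, hi, hne⟩ := hex
  have h1 := Finset.sum_le_sum hle
  rw [Finset.sum_add_distrib, ← hfib, ← hfib] at h1
  have h2 : δ ≤ ∑ i ∈ Finset.range b,
      (if S.filter (fun r => g r = i) = T.filter (fun r => g r = i) then 0 else δ) := by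
    refine le_trans ?_ (Finset.single_le_sum (fun j _ => ?_) hi)
    · rw [if_neg hne]
    · split_ifs <;> simp [hδ]
  linarith

theorem coeff_fredholmCoeff_eq_zero {M : Matrix ι ι K⟦X⟧} {N m : ℕ}
    (h : ∀ S : Finset ι, S.card = N → PowerSeries.coeff m (principalMinor M S) = 0) :
    PowerSeries.coeff m (fredholmCoeff M N) = 0 := by
  rw [fredholmCoeff, PowerSeries.coeff_mk]
  exact finsum_eq_zero_of_forall_eq_zero fun S => h S.1 S.2

/-- At most one summand is nonzero, so the default value of `finsum` on infinite supports plays no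
role. -/
theorem coeff_fredholmCoeff_eq_single {M : Matrix ι ι K⟦X⟧} {N m : ℕ} {T : Finset ι}
    (hT : T.card = N)
    (h : ∀ S : Finset ι, S.card = N → S ≠ T → PowerSeries.coeff m (principalMinor M S) = 0) :
    PowerSeries.coeff m (fredholmCoeff M N) = PowerSeries.coeff m (principalMinor M T) := by
  rw [fredholmCoeff, PowerSeries.coeff_mk]
  exact finsum_eq_single (fun S : {S : Finset ι // S.card = N} =>
    PowerSeries.coeff m (principalMinor M S)) ⟨T, hT⟩
    fun S hS => h S.1 S.2 fun hST => hS (Subtype.ext hST)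

end Minors

/-! ## The entries of the matrix of Dwork's operator -/

section Entries

variable {p : ℕ} [Fact p.Prime] {k : Type*} [Field k] [CharP k p]

/-- Each factor has only terms `π ^ r x ^ (e r)` with `e ≤ d`, and the condition is stable under
products. -/
theorem exists_of_coeff_dworkSeries_ne_zero {a d : ℕ} {f : Polynomial k} {j m : ℕ}
    (h : PowerSeries.coeff m (PowerSeries.coeff j (dworkSeries p a d f)) ≠ 0) :
    ∃ r, m = d * (p ^ a - 1) * r ∧ j ≤ d * r := by
  have key : ∀ s : Finset ℕ, (∀ i ∈ s, i ≤ d) → ∀ j m,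
      PowerSeries.coeff m (PowerSeries.coeff j (∏ i ∈ s,
        artinHasseAt p (d * (p ^ a - 1)) (teichQQ p k (f.coeff i)) i)) ≠ 0 →
      ∃ r, m = d * (p ^ a - 1) * r ∧ j ≤ d * r := by
    intro s
    induction s using Finset.induction_on with
    | empty =>
      intro _ j m hne
      rw [Finset.prod_empty, PowerSeries.coeff_one] at hne
      split_ifs at hne with hj
      · rw [PowerSeries.coeff_one] at hne
        split_ifs at hne with hm
        · exact ⟨0, by simp [hm], by simp [hj]⟩
        · exact absurd rfl hne
      · simp at hne
    | insert i s his ih =>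
      intro hs j m hne
      rw [Finset.prod_insert his, PowerSeries.coeff_mul, map_sum] at hne
      obtain ⟨x, hx, hne⟩ := Finset.exists_ne_zero_of_sum_ne_zero hne
      rw [PowerSeries.coeff_mul] at hne
      obtain ⟨y, hy, hne⟩ := Finset.exists_ne_zero_of_sum_ne_zero hne
      obtain ⟨r, hr1, hr2⟩ := ih (fun j hj => hs j (Finset.mem_insert_of_mem hj)) _ _
        (right_ne_zero_of_mul hne)
      have hl := left_ne_zero_of_mul hne
      rw [artinHasseAt, PowerSeries.coeff_mk, PowerSeries.coeff_mk] at hl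
      obtain ⟨r', -, hr'⟩ := Finset.exists_ne_zero_of_sum_ne_zero hl
      split_ifs at hr' with hc
      · refine ⟨r' + r, ?_, ?_⟩
        · rw [← Finset.HasAntidiagonal.mem_antidiagonal.1 hy, hr1, ← hc.1]; ring
        · rw [← Finset.HasAntidiagonal.mem_antidiagonal.1 hx, ← hc.2, mul_add]
          exact add_le_add (Nat.mul_le_mul_right _ (hs i (Finset.mem_insert_self _ _))) hr2
      · exact absurd rfl hr'
  exact key _ (fun i hi => Nat.lt_succ_iff.1 (Finset.mem_range.1 hi)) j m h

theorem exists_of_coeff_dworkGamma_ne_zero {a d : ℕ} {f : Polynomial k} {n : ℤ} {m : ℕ}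
    (h : PowerSeries.coeff m (dworkGamma p a d f n) ≠ 0) :
    ∃ r : ℕ, m = d * (p ^ a - 1) * r ∧ n ≤ d * r := by
  rw [dworkGamma] at h
  split_ifs at h with hn
  · obtain ⟨r, h1, h2⟩ := exists_of_coeff_dworkSeries_ne_zero h
    refine ⟨r, h1, ?_⟩
    rw [← Int.toNat_of_nonneg hn]
    exact_mod_cast h2
  · simp at h

theorem coeff_mulDworkSeries_monomial {a : ℕ} (hq : p ^ a - 1 ≠ 0) (d : ℕ) (f : Polynomial k)
    (N e : ℕ) (z : QQPi p k) :
    PowerSeries.coeff N (mulDworkSeries p a d f (PowerSeries.monomial e z)) =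
      if e ≤ N ∧ p ^ a - 1 ∣ N - e then
        PowerSeries.coeff ((N - e) / (p ^ a - 1)) (dworkSeries p a d f) * z else 0 := by
  rw [mulDworkSeries, PowerSeries.monomial_eq_C_mul_X_pow, ← mul_assoc,
    PowerSeries.coeff_mul_X_pow']
  by_cases h1 : e ≤ N
  · rw [if_pos h1, PowerSeries.coeff_mul_C, PowerSeries.coeff_subst_X_pow hq]
    by_cases h2 : p ^ a - 1 ∣ N - e
    · rw [if_pos h2, if_pos ⟨h1, h2⟩]
      rfl
    · rw [if_neg h2, if_neg fun h => h2 h.2, zero_mul]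
  · rw [if_neg h1, if_neg fun h => h1 h.1]

variable [Algebra (ZMod p) k] [PerfectRing k p]

/-- `ψ_p` reads the exponent `p (s_i + (q-1) l) = s_{i+1} + (q-1)(p l + v)`. It differs from `s_{i'}
+ (q-1) j` by a multiple of `q - 1` only if `s_{i'} = s_{i+1}`. -/
theorem dworkMatrix_apply {a u : ℕ} (ha : 0 < a) (hu : u < p ^ a - 1) (d : ℕ) (f : Polynomial k)
    (ξ : Module.Basis (Fin a) ℚ_[p] (QQ p k)) (r c : DworkIndex p a u) :
    dworkMatrix p a d u f ξ r c =
      if (c.2.1 : ℕ) = (r.2.1 + 1) % twistPeriod p a u then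
        PowerSeries.mk fun m => ξ.repr ((sigmaQQ p k).symm
          (PowerSeries.coeff m (dworkGamma p a d f ((p : ℤ) * r.2.2 - c.2.2 +
            twistDigit p a u (twistPeriod p a u - (r.2.1 + 1)))) * ξ c.1)) r.1
      else 0 := by
  have hp : 1 < p := (Fact.out : p.Prime).one_lt
  have hQ : 0 < p ^ a - 1 := by omega
  have hmul := mul_twistResidue ha hp hu r.2.1.2
  have hs1 : twistResidue p a u (r.2.1 + 1) < p ^ a - 1 := Nat.mod_lt _ hQ
  have hs2 : twistResidue p a u c.2.1 < p ^ a - 1 := Nat.mod_lt _ hQ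
  have hN : p * dworkExponent r = twistResidue p a u (r.2.1 + 1) +
      (p ^ a - 1) * (p * r.2.2 + twistDigit p a u (twistPeriod p a u - (r.2.1 + 1))) := by
    rw [dworkExponent, mul_add, hmul]; ring
  have hcoeff : PowerSeries.coeff (p * dworkExponent r) (mulDworkSeries p a d f
      (PowerSeries.monomial (dworkExponent c) (PowerSeries.C (ξ c.1)))) =
      if (c.2.1 : ℕ) = (r.2.1 + 1) % twistPeriod p a u then
        dworkGamma p a d f ((p : ℤ) * r.2.2 - c.2.2 +
          twistDigit p a u (twistPeriod p a u - (r.2.1 + 1))) * PowerSeries.C (ξ c.1)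
      else 0 := by
    have hiff := twistResidue_eq_succ_iff (i := r.2.1) ha hu c.2.1.2
    rw [coeff_mulDworkSeries_monomial hQ.ne', hN, dworkExponent]
    generalize twistResidue p a u (r.2.1 + 1) = s at *
    generalize twistResidue p a u c.2.1 = s' at *
    generalize twistDigit p a u (twistPeriod p a u - (r.2.1 + 1)) = v at *
    generalize p ^ a - 1 = Q at *
    by_cases hss : s' = s
    · subst hss
      rw [if_pos (hiff.1 rfl), dworkGamma]
      rcases le_or_gt c.2.2 (p * r.2.2 + v) with hle | hlt
      · have h1 : s' + Q * (p * r.2.2 + v) - (s' + Q * c.2.2) = Q * (p * r.2.2 + v - c.2.2) := by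
          rw [Nat.add_sub_add_left, Nat.mul_sub]
        have h2 : ((p : ℤ) * r.2.2 - c.2.2 + v) = ((p * r.2.2 + v - c.2.2 : ℕ) : ℤ) := by
          push_cast [Nat.cast_sub hle]; ring
        rw [h1, if_pos ⟨Nat.add_le_add_left (Nat.mul_le_mul_left _ hle) _, dvd_mul_right _ _⟩,
          Nat.mul_div_cancel_left _ hQ, h2, if_pos (Int.natCast_nonneg _), Int.toNat_natCast]
      · have h2 : ¬ (0 : ℤ) ≤ (p : ℤ) * r.2.2 - c.2.2 + v := by
          have : ((p * r.2.2 + v : ℕ) : ℤ) < c.2.2 := by exact_mod_cast hlt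
          push_cast at this; linarith
        rw [if_neg h2, zero_mul, if_neg]
        rintro ⟨h3, -⟩
        exact absurd (Nat.le_of_mul_le_mul_left (Nat.le_of_add_le_add_left h3) hQ) (by omega)
    · rw [if_neg fun h => hss (hiff.2 h), if_neg]
      rintro ⟨h3, h4⟩
      have h5 := (Nat.modEq_iff_dvd' h3).2 h4
      rw [Nat.ModEq, Nat.add_mul_mod_self_left, Nat.add_mul_mod_self_left,
        Nat.mod_eq_of_lt hs1, Nat.mod_eq_of_lt hs2] at h5
      exact hss h5
  ext m
  rw [dworkMatrix, Matrix.of_apply, PowerSeries.coeff_mk, dworkOperator, sigmaInv,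
    PowerSeries.coeff_map, psiP, PowerSeries.coeff_mk, hcoeff]
  split_ifs with h
  · rw [PowerSeries.coeff_map, PowerSeries.coeff_mul_C, PowerSeries.coeff_mk]
    rfl
  · simp

/-- The row part of the order of an entry of the matrix of Dwork's operator. -/
def rowOrder {p a u : ℕ} (d t : ℕ) (r : DworkIndex p a u) : ℤ :=
  (d * (p ^ a - 1) : ℕ) *
    ((p * r.2.2 + twistDigit p a u (twistPeriod p a u - (r.2.1 + 1)) + t : ℕ) / (d : ℤ))

/-- The column part of the order of an entry of the matrix of Dwork's operator. -/
def colOrder {p a u : ℕ} (d t : ℕ) (c : DworkIndex p a u) : ℤ :=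
  (d * (p ^ a - 1) : ℕ) * ((c.2.2 + t : ℕ) / (d : ℤ))

theorem rowOrder_sub_colOrder {p a u : ℕ} (d t : ℕ) (r : DworkIndex p a u) :
    rowOrder d t r - colOrder d t r = (d * (p ^ a - 1) : ℕ) *
      twistWeight p d t (twistDigit p a u (twistPeriod p a u - (r.2.1 + 1))) r.2.2 := by
  rw [rowOrder, colOrder, twistWeight, mul_sub]

theorem rowOrder_sub_colOrder_le {a u : ℕ} (ha : 0 < a) (hu : u < p ^ a - 1) {d : ℕ} (hd : 0 < d)
    (t : ℕ) (f : Polynomial k) (ξ : Module.Basis (Fin a) ℚ_[p] (QQ p k))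
    (r c : DworkIndex p a u) (m : ℕ)
    (h : PowerSeries.coeff m (dworkMatrix p a d u f ξ r c) ≠ 0) :
    rowOrder d t r - colOrder d t c ≤ m := by
  rw [dworkMatrix_apply ha hu] at h
  split_ifs at h with hc
  · rw [PowerSeries.coeff_mk] at h
    have h1 : PowerSeries.coeff m (dworkGamma p a d f ((p : ℤ) * r.2.2 - c.2.2 +
            twistDigit p a u (twistPeriod p a u - (r.2.1 + 1)))) ≠ 0 := by
      intro h0
      rw [h0] at h
      simp at h
    obtain ⟨m', rfl, hm'⟩ := exists_of_coeff_dworkGamma_ne_zero h1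
    rw [rowOrder, colOrder, ← mul_sub, Nat.cast_mul (d * (p ^ a - 1))]
    refine mul_le_mul_of_nonneg_left ?_ (Nat.cast_nonneg _)
    refine floor_sub_floor_le hd ?_
    push_cast
    linarith
  · simp at h

end Entries

/-! ## Extension of a basis to power series -/

section PowerSeriesBasis

variable {ι K F : Type*} [Fintype ι] [CommRing K] [CommRing F] [Algebra K F]

/-- A finite basis of an algebra `F` over `K` as a basis of `F⟦X⟧` over `K⟦X⟧`. -/
def powerSeriesBasis (ξ : Module.Basis ι K F) : Module.Basis ι K⟦X⟧ F⟦X⟧ :=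
  Module.Basis.ofEquivFun
    { toFun := fun x w => PowerSeries.mk fun m => ξ.repr (PowerSeries.coeff m x) w
      invFun := fun g => PowerSeries.mk fun m => ∑ w, PowerSeries.coeff m (g w) • ξ w
      map_add' := fun x y => by ext w m; simp
      map_smul' := fun r x => by
        ext w m
        simp only [RingHom.id_apply, Pi.smul_apply, smul_eq_mul]
        simp only [Algebra.smul_def, PowerSeries.algebraMap_apply'', PowerSeries.coeff_mk,
          PowerSeries.coeff_mul, PowerSeries.coeff_map, map_sum, Finsupp.coe_finsetSum,
          Finset.sum_apply]
        refine Finset.sum_congr rfl fun y _ => ?_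
        rw [← Algebra.smul_def, map_smul, Finsupp.smul_apply, smul_eq_mul]
      left_inv := fun x => by
        ext m
        simp [ξ.sum_repr]
      right_inv := fun g => by
        classical
        ext w m
        simp [Finsupp.single_apply] }

theorem coeff_powerSeriesBasis_repr (ξ : Module.Basis ι K F) (x : F⟦X⟧) (w : ι) (m : ℕ) :
    PowerSeries.coeff m ((powerSeriesBasis ξ).repr x w) = ξ.repr (PowerSeries.coeff m x) w := by
  rw [powerSeriesBasis, Module.Basis.ofEquivFun_repr_apply]
  simp

theorem powerSeriesBasis_apply (ξ : Module.Basis ι K F) (v : ι) :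
    powerSeriesBasis ξ v = PowerSeries.C (ξ v) := by
  classical
  rw [powerSeriesBasis, Module.Basis.coe_ofEquivFun]
  ext m
  simp only [LinearEquiv.coe_symm_mk', PowerSeries.coeff_mk, PowerSeries.coeff_C]
  split_ifs with hm
  · subst hm
    rw [Finset.sum_eq_single v]
    · simp
    · intro w _ hw; simp [hw]
    · simp
  · refine Finset.sum_eq_zero fun w _ => ?_
    by_cases hw : w = v
    · subst hw; simp [PowerSeries.coeff_one, hm]
    · simp [hw]

theorem coeff_leftMulMatrix_powerSeriesBasis [DecidableEq ι] (ξ : Module.Basis ι K F) (g : F⟦X⟧)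
    (w v : ι) (m : ℕ) :
    PowerSeries.coeff m (Algebra.leftMulMatrix (powerSeriesBasis ξ) g w v) =
      ξ.repr (PowerSeries.coeff m g * ξ v) w := by
  rw [Algebra.leftMulMatrix_eq_repr_mul, coeff_powerSeriesBasis_repr, powerSeriesBasis_apply,
    PowerSeries.coeff_mul_C]

end PowerSeriesBasis

/-! ## The Frobenius and normal bases -/

section Frobenius

variable (p : ℕ) [Fact p.Prime] (k : Type*) [Field k] [CharP k p] [Algebra (ZMod p) k]
  [PerfectRing k p]

/-- Frobenius raises Witt coordinates to the `p`-th power, which fixes those in `𝔽_p`. -/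
theorem sigmaQQ_algebraMap (x : ℚ_[p]) :
    sigmaQQ p k (algebraMap ℚ_[p] (QQ p k) x) = algebraMap ℚ_[p] (QQ p k) x := by
  have h : (sigmaQQ p k).toRingHom.comp (algebraMap ℚ_[p] (QQ p k)) =
      algebraMap ℚ_[p] (QQ p k) := by
    refine IsLocalization.ringHom_ext (nonZeroDivisors ℤ_[p]) (RingHom.ext fun z => ?_)
    have hz : algebraMap ℚ_[p] (QQ p k) (algebraMap ℤ_[p] ℚ_[p] z) = padicIntToQQ p k z :=
      IsFractionRing.lift_algebraMap (padicIntToQQ_injective p k) z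
    simp only [RingHom.comp_apply, hz]
    change sigmaQQ p k (algebraMap (WittVector p k) (QQ p k) _) =
      algebraMap (WittVector p k) (QQ p k) _
    rw [sigmaQQ, IsFractionRing.ringEquivOfRingEquiv_algebraMap]
    congr 1
    ext n
    change (WittVector.frobenius _).coeff n = _
    rw [WittVector.coeff_frobenius_charP]
    simp only [WittVector.map_coeff]
    rw [← map_pow, ZMod.pow_card]
  exact congrArg (fun g : ℚ_[p] →+* QQ p k => g x) h

/-- The inverse of the Frobenius automorphism of `ℚ_q` as an automorphism over `ℚ_p`. -/
def sigmaInvAlgEquiv : QQ p k ≃ₐ[ℚ_[p]] QQ p k :=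
  AlgEquiv.ofRingEquiv (f := (sigmaQQ p k).symm) fun x => by
    rw [RingEquiv.symm_apply_eq, sigmaQQ_algebraMap]

end Frobenius

/-- An automorphism permutes the conjugates of `θ`, hence the basis, hence the coordinates. -/
theorem exists_perm_of_normal_basis {ι K F : Type*} [Finite ι] [Field K] [Field F] [Algebra K F]
    (ξ : Module.Basis ι K F)
    (hξ : ∃ θ : F, Set.range ξ = Set.range (fun τ : F ≃ₐ[K] F => τ θ)) (τ : F ≃ₐ[K] F) :
    ∃ π : Equiv.Perm ι, ∀ x w, ξ.repr (τ x) (π w) = ξ.repr x w := by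
  obtain ⟨θ, hθ⟩ := hξ
  have h1 : ∀ v, ∃ w, ξ w = τ (ξ v) := by
    intro v
    obtain ⟨τ', hτ'⟩ : ξ v ∈ Set.range (fun τ : F ≃ₐ[K] F => τ θ) := hθ ▸ Set.mem_range_self v
    have : τ (ξ v) ∈ Set.range ξ := by
      rw [hθ, ← hτ']
      exact ⟨τ'.trans τ, rfl⟩
    exact this
  choose g hg using h1
  have hinj : Function.Injective g := fun v w h => by
    have := hg v
    rw [h, hg w] at this
    exact ξ.injective (τ.injective this).symm
  refine ⟨Equiv.ofBijective g (Finite.injective_iff_bijective.1 hinj), fun x w => ?_⟩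
  have hlin : (Finsupp.lapply (g w) ∘ₗ ξ.repr.toLinearMap) ∘ₗ τ.toLinearMap =
      Finsupp.lapply w ∘ₗ ξ.repr.toLinearMap := by
    classical
    refine ξ.ext fun v => ?_
    simp [← hg v, Finsupp.single_apply, hinj.eq_iff]
  exact LinearMap.congr_fun hlin x

/-! ## The leading principal minor -/

theorem exists_det_submatrix_perm {n R : Type*} [Fintype n] [DecidableEq n] [CommRing R]
    (M : Matrix n n R) (e₁ e₂ : Equiv.Perm n) :
    ∃ e : ℤˣ, M.det = ((e : ℤ) : R) * (M.submatrix e₁ e₂).det := by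
  have h : M.submatrix e₁ e₂ = (M.submatrix (e₂.symm.trans e₁) id).submatrix e₂ e₂ := by
    ext i j; simp
  refine ⟨Equiv.Perm.sign (e₂.symm.trans e₁), ?_⟩
  rw [h, Matrix.det_submatrix_equiv_self, Matrix.det_permute, ← mul_assoc, ← Int.cast_mul,
    ← Units.val_mul, Int.units_mul_self]
  simp

theorem exists_perm_fin_succ_mod (b : ℕ) :
    ∃ ρ : Equiv.Perm (Fin b), ∀ i, (ρ i : ℕ) = (i + 1) % b := by
  cases b with
  | zero => exact ⟨1, fun i => i.elim0⟩
  | succ b =>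
    refine ⟨finRotate (b + 1), fun i => ?_⟩
    rw [finRotate_apply, Fin.val_add]
    simp

section LeadingMinor

variable {p : ℕ} [Fact p.Prime] {k : Type*} [Field k] [CharP k p] [Algebra (ZMod p) k]
  [PerfectRing k p]

/-- The indices `(v, i, j)` with `j < n`. -/
def leadingIndices (p a u n : ℕ) : Finset (DworkIndex p a u) :=
  Finset.univ ×ˢ Finset.univ ×ˢ Finset.range n

theorem mem_leadingIndices {p a u n : ℕ} {r : DworkIndex p a u} :
    r ∈ leadingIndices p a u n ↔ r.2.2 < n := by
  simp [leadingIndices]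

/-- The leading indices as a product. -/
def leadingIndicesEquiv (p a u n : ℕ) :
    (Fin n × Fin (twistPeriod p a u)) × Fin a ≃ leadingIndices p a u n where
  toFun x := ⟨(x.2, x.1.2, x.1.1), mem_leadingIndices.2 x.1.1.2⟩
  invFun r := ((⟨r.1.2.2, mem_leadingIndices.1 r.2⟩, r.1.2.1), r.1.1)
  left_inv _ := rfl
  right_inv _ := rfl

theorem principalMinor_leadingIndices {a u : ℕ} (ha : 0 < a) (hu : u < p ^ a - 1) (d : ℕ)
    (f : Polynomial k) (ξ : Module.Basis (Fin a) ℚ_[p] (QQ p k))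
    (hξ : ∃ θ : QQ p k,
      Set.range ξ = Set.range (fun τ : QQ p k ≃ₐ[ℚ_[p]] QQ p k => τ θ)) (n : ℕ) :
    ∃ e : ℤˣ, principalMinor (dworkMatrix p a d u f ξ) (leadingIndices p a u n) =
      ((e : ℤ) : (ℚ_[p])⟦X⟧) * Algebra.norm (ℚ_[p])⟦X⟧
        (∏ i ∈ Finset.Icc 1 (twistPeriod p a u), (Matrix.of fun l j : Fin n =>
          dworkGamma p a d f ((p : ℤ) * (l : ℕ) - (j : ℕ) +
            twistDigit p a u (twistPeriod p a u - i))).det) := by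
  set b := twistPeriod p a u with hb
  set A : ℕ → Matrix (Fin n) (Fin n) (QQPi p k) := fun i => Matrix.of fun l j : Fin n =>
    dworkGamma p a d f ((p : ℤ) * (l : ℕ) - (j : ℕ) + twistDigit p a u (b - i)) with hA
  obtain ⟨π, hπ⟩ := exists_perm_of_normal_basis ξ hξ (sigmaInvAlgEquiv p k)
  obtain ⟨ρ, hρ⟩ := exists_perm_fin_succ_mod b
  set M : Matrix ((Fin n × Fin b) × Fin a) ((Fin n × Fin b) × Fin a) (ℚ_[p])⟦X⟧ :=
    (dworkMatrix p a d u f ξ).submatrix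
      (fun x => (leadingIndicesEquiv p a u n x : DworkIndex p a u))
      (fun x => (leadingIndicesEquiv p a u n x : DworkIndex p a u)) with hM
  have hdet : principalMinor (dworkMatrix p a d u f ξ) (leadingIndices p a u n) = M.det := by
    rw [principalMinor, ← Matrix.det_submatrix_equiv_self (leadingIndicesEquiv p a u n)]
    rfl
  set Λ := (Algebra.leftMulMatrix (powerSeriesBasis ξ)).toRingHom with hΛ
  set G : Matrix (Fin n × Fin b) (Fin n × Fin b) (QQPi p k) :=
    Matrix.blockDiagonal fun i : Fin b => A (i + 1) with hG
  obtain ⟨e, he⟩ := exists_det_submatrix_perm M ((Equiv.refl _).prodCongr π)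
    (((Equiv.refl _).prodCongr ρ).prodCongr (Equiv.refl _))
  refine ⟨e, ?_⟩
  -- `π` on rows undoes `σ⁻¹`, and `ρ` on columns undoes the shift from block `i` to `i + 1`.
  have hN : M.submatrix ((Equiv.refl _).prodCongr π)
      (((Equiv.refl _).prodCongr ρ).prodCongr (Equiv.refl _)) =
      (G.map Λ).comp _ _ (Fin a) (Fin a) _ := by
    ext ⟨⟨l, i⟩, w⟩ ⟨⟨j, i'⟩, v⟩ m
    rw [Matrix.comp_apply, Matrix.map_apply, hG, Matrix.blockDiagonal_apply]
    simp only [hM, Matrix.submatrix_apply]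
    rw [dworkMatrix_apply ha hu]
    have hiff : ((ρ i' : Fin b) : ℕ) = (i + 1) % b ↔ i = i' := by
      rw [← hρ i, ← Fin.ext_iff, ρ.injective.eq_iff, eq_comm]
    by_cases hii : i = i'
    · rw [if_pos hii]
      refine (congrArg _ (if_pos (hiff.2 hii))).trans ?_
      rw [PowerSeries.coeff_mk]
      refine Eq.trans ?_ (coeff_leftMulMatrix_powerSeriesBasis ξ _ w v m).symm
      exact hπ _ w
    · rw [if_neg hii, map_zero]
      exact congrArg _ (if_neg fun h => hii (hiff.1 h))
  have hprod : ∏ i ∈ Finset.Icc 1 b, (A i).det = G.det := by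
    rw [hG, Matrix.det_blockDiagonal, Fin.prod_univ_eq_prod_range (fun i => (A (i + 1)).det) b,
      Finset.range_eq_Ico, Finset.prod_Ico_add' (fun i => (A i).det) 0 b 1]
    rfl
  -- The blocks commute, so the large determinant is that of multiplication by `G.det`, which is its
  -- norm.
  rw [hdet, he, hN, ← Matrix.det_det, hprod, Algebra.norm_eq_matrix_det (powerSeriesBasis ξ)]
  rfl

end LeadingMinor

/-! ## Comparison of the principal minors -/

section Comparison

/-- The weight of an index of the matrix of Dwork's operator. -/
def indexWeight {p a u : ℕ} (d t : ℕ) (r : DworkIndex p a u) : ℤ :=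
  twistWeight p d t (twistDigit p a u (twistPeriod p a u - (r.2.1 + 1))) r.2.2

theorem mul_arithmeticPolygon_le {p a u d : ℕ} (hp : p.Prime) (ha : 0 < a) (hu : u < p ^ a - 1)
    (hd : 0 < d) (hpd : 3 * d < p) {n t : ℕ} (ht : t < d) (hnt : d ∣ n + t) :
    (a * twistPeriod p a u * arithmeticPolygon p a d u n : ℚ) ≤
      ((∑ r ∈ leadingIndices p a u n, indexWeight d t r : ℤ) : ℚ) := by
  set b := twistPeriod p a u with hb
  have hb0 : 0 < b := (twistPeriod_spec ha hu).1
  have hcop : Nat.Coprime p d :=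
    (hp.coprime_iff_not_dvd).2 fun h => absurd (Nat.le_of_dvd hd h) (by omega)
  have hW : ∑ r ∈ leadingIndices p a u n, indexWeight d t r =
      a * ∑ i ∈ Finset.range b, ∑ m ∈ Finset.range n,
        twistWeight p d t (twistDigit p a u (b - (i + 1))) m := by
    have hv : ∀ v : Fin a, ∑ y ∈ Finset.univ ×ˢ Finset.range n,
        indexWeight (p := p) (u := u) d t (v, y) = ∑ i ∈ Finset.range b, ∑ m ∈ Finset.range n,
          twistWeight p d t (twistDigit p a u (b - (i + 1))) m := fun v => by
      rw [Finset.sum_product, ← Fin.sum_univ_eq_sum_range (fun i => ∑ m ∈ Finset.range n,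
        twistWeight p d t (twistDigit p a u (b - (i + 1))) m) b]
      rfl
    rw [leadingIndices, Finset.sum_product, Finset.sum_congr rfl fun v _ => hv v,
      Finset.sum_const, Finset.card_univ, Fintype.card_fin, nsmul_eq_mul]
  -- The polygon uses the digits `u_b, …, u_1`, the matrix `u_{b-1}, …, u_0`; the sums agree because
  -- `u_b = u_0`.
  have hrot : ∑ i ∈ Finset.range b, ∑ m ∈ Finset.range n,
      twistWeight p d t (twistDigit p a u (b - i)) m =
      ∑ i ∈ Finset.range b, ∑ m ∈ Finset.range n,
        twistWeight p d t (twistDigit p a u (b - (i + 1))) m := by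
    have h1 := Finset.sum_range_succ (fun i => ∑ m ∈ Finset.range n,
      twistWeight p d t (twistDigit p a u (b - i)) m) b
    rw [Finset.sum_range_succ'] at h1
    simp only [Nat.sub_self, Nat.sub_zero, twistDigit_period ha hp.one_lt hu, hb] at h1 ⊢
    linarith
  have hP : (a * b * arithmeticPolygon p a d u n : ℚ) =
      ((a * ∑ i ∈ Finset.range b, ∑ m ∈ Finset.range n,
        (⌈(((p : ℚ) - 1) * m + twistDigit p a u (b - i)) / d⌉ - deltaIn p a d u i m) : ℤ) : ℚ) := by
    have hb' : (b : ℚ) ≠ 0 := by positivity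
    rw [Finset.sum_comm, arithmeticPolygon]
    simp only [arithmeticSlope]
    rw [← Finset.mul_sum, mul_assoc, ← mul_assoc (b : ℚ), mul_one_div_cancel hb', one_mul]
    push_cast
    rfl
  rw [hP, hW, ← hrot]
  refine Int.cast_le.2 (mul_le_mul_of_nonneg_left (Finset.sum_le_sum fun i _ => ?_)
    (Nat.cast_nonneg _))
  exact sum_ceil_sub_delta_le hcop hd _ n t ht hnt

theorem card_leadingIndices (p a u n : ℕ) :
    (leadingIndices p a u n).card = a * twistPeriod p a u * n := by
  simp [leadingIndices, mul_assoc]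

theorem card_fiber_leadingIndices {p a u n i : ℕ} (hi : i < twistPeriod p a u) :
    ((leadingIndices p a u n).filter fun r => (r.2.1 : ℕ) = i).card = a * n := by
  have : ((leadingIndices p a u n).filter fun r => (r.2.1 : ℕ) = i) =
      Finset.univ ×ˢ {⟨i, hi⟩} ×ˢ Finset.range n := by
    ext r
    simp only [Finset.mem_filter, mem_leadingIndices, Finset.mem_product, Finset.mem_univ,
      Finset.mem_singleton, Fin.ext_iff, Finset.mem_range, true_and]
    tauto
  rw [this]
  simp

variable {p : ℕ} [Fact p.Prime] {k : Type*} [Field k] [CharP k p] [Algebra (ZMod p) k]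
  [PerfectRing k p] {a u d : ℕ}

theorem sum_indexWeight_le (ha : 0 < a) (hu : u < p ^ a - 1) (hd : 0 < d) (t : ℕ)
    (f : Polynomial k) (ξ : Module.Basis (Fin a) ℚ_[p] (QQ p k))
    {S : Finset (DworkIndex p a u)} {m : ℕ}
    (hm : PowerSeries.coeff m (principalMinor (dworkMatrix p a d u f ξ) S) ≠ 0) :
    (d * (p ^ a - 1) : ℕ) * ∑ r ∈ S, indexWeight d t r ≤ m := by
  have h := (sum_le_of_coeff_principalMinor_ne_zero _ (rowOrder d t) (colOrder d t)
    (rowOrder_sub_colOrder_le ha hu hd t f ξ) hm).1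
  rw [Finset.sum_congr rfl fun r _ => rowOrder_sub_colOrder d t r] at h
  rw [Finset.mul_sum]
  exact h

/-- With `t = 0` an index of exponent `j` weighs at least `2 j`, so a minor in which `ϖ ^ m` occurs
uses only exponents at most `m`. -/
theorem minorsConverge_dworkMatrix (ha : 0 < a) (hu : u < p ^ a - 1) (hd : 0 < d)
    (hpd : 3 * d < p) (f : Polynomial k) (ξ : Module.Basis (Fin a) ℚ_[p] (QQ p k)) (N : ℕ) :
    MinorsConverge (dworkMatrix p a d u f ξ) N := by
  intro m
  refine Set.Finite.subset (leadingIndices p a u (m + 1)).powerset.finite_toSet ?_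
  rintro S ⟨-, hS⟩
  refine Finset.mem_coe.2 (Finset.mem_powerset.2 fun r hr => mem_leadingIndices.2 ?_)
  have h1 := sum_indexWeight_le ha hu hd 0 f ξ hS
  have hnn : ∀ s : DworkIndex p a u, 2 * (s.2.2 : ℤ) ≤ indexWeight d 0 s := fun s =>
    two_mul_le_twistWeight hd hpd _ _ _
  have h2 : indexWeight d 0 r ≤ ∑ r ∈ S, indexWeight d 0 r :=
    Finset.single_le_sum (fun s _ => le_trans (by positivity) (hnn s)) hr
  have h3 : (1 : ℤ) ≤ (d * (p ^ a - 1) : ℕ) := by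
    exact_mod_cast Nat.mul_pos hd (by omega)
  have h4 := hnn r
  have h5 : (0 : ℤ) ≤ r.2.2 := by positivity
  have h6 : ∑ r ∈ S, indexWeight d 0 r ≤ (d * (p ^ a - 1) : ℕ) * ∑ r ∈ S, indexWeight d 0 r :=
    le_mul_of_one_le_left (by linarith) h3
  have h7 : (r.2.2 : ℤ) < (m + 1 : ℕ) := by push_cast; linarith
  exact_mod_cast h7

theorem sum_indexWeight_add_le (ha : 0 < a) (hu : u < p ^ a - 1) (hd : 0 < d) (hpd : 3 * d < p)
    (t : ℕ) (f : Polynomial k) (ξ : Module.Basis (Fin a) ℚ_[p] (QQ p k)) {n : ℕ}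
    {S : Finset (DworkIndex p a u)} (hcard : S.card = a * twistPeriod p a u * n)
    (hS : S ≠ leadingIndices p a u n) {m : ℕ}
    (hm : PowerSeries.coeff m (principalMinor (dworkMatrix p a d u f ξ) S) ≠ 0) :
    ∑ r ∈ leadingIndices p a u n, indexWeight d t r + 2 ≤ ∑ r ∈ S, indexWeight d t r := by
  have hb := (twistPeriod_spec ha hu).1
  set g : DworkIndex p a u → ℕ := fun r => r.2.1 with hg
  have hgb : ∀ r, g r < twistPeriod p a u := fun r => r.2.1.2
  obtain ⟨τ, hτ⟩ := (sum_le_of_coeff_principalMinor_ne_zero _ (rowOrder d t) (colOrder d t)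
    (rowOrder_sub_colOrder_le ha hu hd t f ξ) hm).2
  have hfib : ∀ i < twistPeriod p a u,
      (S.filter fun r => g r = i).card = (S.filter fun r => g r = 0).card := fun i hi => by
    refine card_fiber_eq_of_perm (dworkMatrix p a d u f ξ) g hb (fun r c hne => ?_) τ hτ hi
    rw [dworkMatrix_apply ha hu] at hne
    by_contra hcon
    exact hne (if_neg hcon)
  have h0 := card_fiber_mul g hgb hfib
  rw [hcard, mul_comm a, mul_assoc] at h0
  have h1 := Nat.eq_of_mul_eq_mul_left hb h0
  refine sum_add_le_sum_of_card_fiber_eq g hgb (fun i hi => ?_) _ (by norm_num) ?_ hS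
  · rw [hfib i hi, h1, card_fiber_leadingIndices hi]
  · intro r hr s hs hrs
    rw [mem_leadingIndices] at hr hs
    obtain ⟨h, hh⟩ := Nat.exists_eq_add_of_lt (hr.trans_le (not_lt.1 hs))
    rw [indexWeight, indexWeight, hh, show (r.2.1 : ℕ) = s.2.1 from hrs, add_assoc]
    refine le_trans ?_ (twistWeight_add_le hd hpd _ _ _ _)
    push_cast
    linarith [Int.natCast_nonneg h]

end Comparison

end

theorem mainTheorem7 (p : ℕ) [Fact p.Prime] {k : Type*} [Field k] [Finite k] [CharP k p]
    [Algebra (ZMod p) k] (a : ℕ) (hq : Nat.card k = p ^ a)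
    (d : ℕ) (hd : 1 ≤ d) (u : ℕ) (hu : u < p ^ a - 1)
    (f : Polynomial k) (hf : f.natDegree ≤ d)
    (hp : (p : ℝ) > 4 * d - twistEpsilon p a d u)
    (ξ : Module.Basis (Fin a) ℚ_[p] (QQ p k))
    (hξ : ∃ θ : QQ p k,
      Set.range ξ = Set.range (fun τ : QQ p k ≃ₐ[ℚ_[p]] QQ p k => τ θ))
    (n : ℕ) :
    MinorsConverge (dworkMatrix p a d u f ξ) (a * twistPeriod p a u * n) ∧
    ((a * twistPeriod p a u * arithmeticPolygon p a d u n : ℚ) : WithTop ℚ) ≤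
      piOrder (d * (p ^ a - 1))
        (fredholmCoeff (dworkMatrix p a d u f ξ) (a * twistPeriod p a u * n)) ∧
    ∃ e : ℤˣ,
      ((a * twistPeriod p a u * arithmeticPolygon p a d u n +
          1 / ((d : ℚ) * ((p : ℚ) ^ a - 1)) : ℚ) : WithTop ℚ) ≤
        piOrder (d * (p ^ a - 1))
          (fredholmCoeff (dworkMatrix p a d u f ξ) (a * twistPeriod p a u * n) -
            ((e : ℤ) : (ℚ_[p])⟦X⟧) *
              Algebra.norm (ℚ_[p])⟦X⟧
                (∏ i ∈ Finset.Icc 1 (twistPeriod p a u),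
                  (Matrix.of fun l j : Fin n =>
                    dworkGamma p a d f
                      ((p : ℤ) * (l : ℕ) - (j : ℕ) +
                        twistDigit p a u (twistPeriod p a u - i))).det)) := by
  have hprime : p.Prime := Fact.out
  have ha : 0 < a := Nat.pos_of_ne_zero (by rintro rfl; simp at hu)
  have hd : 0 < d := hd
  have hpd : 3 * d < p := by
    have h := twistEpsilon_le ha hu d
    have h' : (3 * d : ℝ) < p := by linarith
    exact_mod_cast h'
  -- This shift makes `n` and `R = d - t` congruent modulo `d`, as the comparison with the polygon
  -- needs.
  obtain ⟨t, ht, hnt⟩ : ∃ t < d, d ∣ n + t := by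
    have hlt := Nat.mod_lt n hd
    have hdm := Nat.div_add_mod n d
    rcases Nat.eq_zero_or_pos (n % d) with h0 | h0
    · exact ⟨0, hd, n / d, by omega⟩
    · exact ⟨d - n % d, by omega, n / d + 1, by rw [mul_add]; omega⟩
  have hP := mul_arithmeticPolygon_le hprime ha hu hd hpd ht hnt
  set D := d * (p ^ a - 1) with hD
  have hD0 : 0 < D := Nat.mul_pos hd (by omega)
  have hDq : (0 : ℚ) < D := by exact_mod_cast hD0
  have hDeq : (d : ℚ) * ((p : ℚ) ^ a - 1) = D := by
    rw [hD, Nat.cast_mul, Nat.cast_sub (Nat.one_le_pow _ _ hprime.pos)]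
    push_cast
    rfl
  obtain ⟨e, he⟩ := principalMinor_leadingIndices ha hu d f ξ hξ n
  set W := ∑ r ∈ leadingIndices p a u n, indexWeight d t r with hW
  have hother : ∀ S : Finset (DworkIndex p a u), S.card = a * twistPeriod p a u * n →
      S ≠ leadingIndices p a u n → ∀ m : ℕ,
      PowerSeries.coeff m (principalMinor (dworkMatrix p a d u f ξ) S) ≠ 0 →
      (W : ℚ) + 2 ≤ m / D := by
    intro S hcard hS m hm
    have h1 := sum_indexWeight_add_le ha hu hd hpd t f ξ hcard hS hm
    have h2 := sum_indexWeight_le ha hu hd t f ξ hm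
    have h3 : (D : ℤ) * (W + 2) ≤ m :=
      (mul_le_mul_of_nonneg_left h1 (Nat.cast_nonneg _)).trans h2
    rw [le_div_iff₀ hDq, mul_comm]
    exact_mod_cast h3
  have hall : ∀ S : Finset (DworkIndex p a u), S.card = a * twistPeriod p a u * n → ∀ m : ℕ,
      PowerSeries.coeff m (principalMinor (dworkMatrix p a d u f ξ) S) ≠ 0 →
      (W : ℚ) ≤ m / D := by
    intro S hcard m hm
    by_cases hS : S = leadingIndices p a u n
    · have h2 : (D : ℤ) * W ≤ m := by
        have := sum_indexWeight_le ha hu hd t f ξ hm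
        rwa [hS] at this
      rw [le_div_iff₀ hDq, mul_comm]
      exact_mod_cast h2
    · linarith [hother S hcard hS m hm]
  refine ⟨minorsConverge_dworkMatrix ha hu hd hpd f ξ _, le_piOrder fun m hm => ?_, e,
    le_piOrder fun m hm => ?_⟩
  · refine coeff_fredholmCoeff_eq_zero fun S hcard => ?_
    by_contra hne
    linarith [hall S hcard m hne]
  · rw [← he, map_sub, sub_eq_zero]
    refine coeff_fredholmCoeff_eq_single (card_leadingIndices p a u n) fun S hcard hS => ?_
    by_contra hne
    have h1 := hother S hcard hS m hne
    -- The gap of 2 between the leading minor and the others exceeds the required `1 / D`.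
    have h2 : (1 : ℚ) / D ≤ 1 := by
      rw [div_le_one hDq]
      exact_mod_cast hD0
    rw [hDeq] at hm
    linarith
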